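/- A depth-$d$ QAC-circuit on a finite set $Q$ of qubits consists of $d$ layers of C-SIGN gates, together with an arbitrary single-qubit unitary gate on every qubit before the first layer, between consecutive layers, and after the last layer (single-qubit gates do not count towards the depth). The C-SIGN gate on a set $S\subseteq Q$ is the unitary operator $|s\rangle\mapsto(-1)^{\prod_{j\in S}s_j}|s\rangle$ for $s\in\{0,1\}^Q$. A layer may contain any number of C-SIGN gates, of any arities, acting on pairwise disjoint sets of qubits; it may be empty. Let $f:\{0,1\}^n\to\{0,1\}$ and $m\ge 0$. A circuit $C$ on $1+n+m$ qubits (one target, $n$ input qubits, $m$ ancilla qubits) computes $f$ if for every $x\in\{0,1\}^n$ there is an $(n+m)$-qubit state $|\varphi_x\rangle$, which may be arbitrary, such that $$C\bigl(|0\rangle\otimes|x\rangle\otimes|0^m\rangle\bigr)=|f(x)\rangle\otimes|\varphi_x\rangle .$$ Let $\oplus_n(x)=x_1+\cdots+x_n \bmod 2$. Theorem. For every $n>3$ and every number $m\ge 0$ of ancilla qubits, no depth-$2$ QAC-circuit on $1+n+m$ qubits computes $\oplus_n$. The bound is tight: there is a depth-$2$ QAC-circuit on $4$ qubits (one target, three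 inputs, no ancillas) that computes $\oplus_3$. -/

import Mathlib

open scoped BigOperators Matrix

namespace QAC

/-- Vectors of the Hilbert space of the qubits labelled by `Q`, written by their amplitudes in the
computational basis `|s⟩`, `s : Q → Fin 2`. -/
abbrev Vec (Q : Type) : Type := (Q → Fin 2) → ℂ

/-- Operators on the Hilbert space of the qubits labelled by `Q`, as matrices in the
computational basis. -/
abbrev Op (Q : Type) : Type := Matrix (Q → Fin 2) (Q → Fin 2) ℂ

/-- A (pure) state: a vector of norm one. -/
def IsState {Q : Type} [Fintype Q] [DecidableEq Q] (ψ : Vec Q) : Prop :=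
  ∑ s, ‖ψ s‖ ^ 2 = 1

/-- The computational basis vector `|s⟩`. -/
def ket {Q : Type} [Fintype Q] [DecidableEq Q] (s : Q → Fin 2) : Vec Q :=
  Pi.single s 1

/-- The tensor product `ψ ⊗ φ` of vectors on two disjoint sets of qubits. -/
def tensor {A B : Type} (ψ : Vec A) (φ : Vec B) : Vec (A ⊕ B) :=
  fun s => ψ (fun a => s (Sum.inl a)) * φ (fun b => s (Sum.inr b))

/-- The tensor product `⨂ j, U j` of single-qubit unitary gates, one on each qubit. -/
def singleQubitOp {Q : Type} [Fintype Q] (U : Q → Matrix.unitaryGroup (Fin 2) ℂ) : Op Q :=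
  Matrix.of fun s t => ∏ j, (U j : Matrix (Fin 2) (Fin 2) ℂ) (s j) (t j)

/-- The phase `(-1) ^ (∏ j ∈ S, s j)` by which the C-SIGN gate on the qubits in `S` multiplies
`|s⟩`. -/
def csignPhase {Q : Type} (S : Finset Q) (s : Q → Fin 2) : ℂ :=
  (-1) ^ (∏ j ∈ S, (s j : ℕ))

/-- A layer of C-SIGN gates of arbitrary arities acting on pairwise disjoint sets of qubits. -/
structure CSignLayer (Q : Type) where
  /-- The sets of qubits on which the layer has a C-SIGN gate. -/
  gates : Finset (Finset Q)
  /-- No qubit is touched by two gates of the layer. -/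
  disjoint : (gates : Set (Finset Q)).PairwiseDisjoint id

/-- The operator of a layer of C-SIGN gates: the product of its gates, all of which are diagonal. -/
def CSignLayer.op {Q : Type} [Fintype Q] [DecidableEq Q] (L : CSignLayer Q) : Op Q :=
  Matrix.diagonal fun s => ∏ S ∈ L.gates, csignPhase S s

/-- QAC-circuits of depth `d` on the qubits labelled by `Q`: there are `d` layers of C-SIGN gates,
and before, between and after these layers an arbitrary single-qubit gate on every qubit.
Single-qubit gates do not count towards the depth. -/
inductive Circuit (Q : Type) : ℕ → Type
  /-- A depth-`0` circuit: one single-qubit gate on each qubit. -/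
  | base (U : Q → Matrix.unitaryGroup (Fin 2) ℂ) : Circuit Q 0
  /-- First the circuit `C`, then the layer `L` of C-SIGN gates, then the single-qubit gates `U`. -/
  | step {d : ℕ} (C : Circuit Q d) (L : CSignLayer Q)
      (U : Q → Matrix.unitaryGroup (Fin 2) ℂ) : Circuit Q (d + 1)

/-- The operator that a circuit implements. -/
def Circuit.op {Q : Type} [Fintype Q] [DecidableEq Q] : {d : ℕ} → Circuit Q d → Op Q
  | _, .base U => singleQubitOp U
  | _, .step C L U => singleQubitOp U * L.op * C.op

/-- The `1 + n + m` qubits of a circuit that computes a function of `n` bits: the target,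
`n` input qubits and `m` ancilla qubits. -/
abbrev Register (n m : ℕ) : Type := Unit ⊕ (Fin n ⊕ Fin m)

/-- `C` `|α⟩`-computes `f`: for every input `x`, the circuit maps `|0⟩ ⊗ |x⟩ ⊗ |α⟩` to
`|f x⟩ ⊗ |φ⟩` for some state `|φ⟩` of the non-target qubits, which may depend on `x`. -/
def Circuit.AncillaComputes {n m d : ℕ} (C : Circuit (Register n m) d) (α : Vec (Fin m))
    (f : (Fin n → Fin 2) → Fin 2) : Prop :=
  ∀ x : Fin n → Fin 2, ∃ φ : Vec (Fin n ⊕ Fin m), IsState φ ∧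
    C.op *ᵥ (tensor (ket fun _ : Unit => 0) (tensor (ket x) α)) =
      tensor (ket fun _ : Unit => f x) φ

/-- `C` computes `f`: it does so with all ancilla qubits initially `|0⟩`. -/
def Circuit.Computes {n m d : ℕ} (C : Circuit (Register n m) d)
    (f : (Fin n → Fin 2) → Fin 2) : Prop :=
  C.AncillaComputes (ket fun _ : Fin m => 0) f

/-- The parity `⊕ₙ x` of an `n`-bit string: its Hamming weight modulo `2`. -/
def parity (n : ℕ) (x : Fin n → Fin 2) : Fin 2 :=
  Fin.ofNat 2 (∑ i, (x i : ℕ))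

end QAC

/-!
Let `K` be the set of input bits with value `1`. Write `E j = V j * U j` for the product of the
first two single-qubit gates on the qubit `j`. A C-SIGN gate is `1 - 2 P`, where `P` projects onto
the all-ones string, so after the first layer and the gates `V` the state is a product over the
blocks `T` of the layer (its gates and the untouched qubits) of vectors `colVec E K T - κ *
prodVec g T`: a product of columns of the `E j`, selected by the input, minus a multiple of a
product vector that does not depend on the input (`singleQubitOp_mulVec_layer_mulVec_ket`). Only
the gate `S` of the second layer that contains the target `t` matters for the final value of the
target, and it again subtracts a multiple of an all-ones projection.

The arguments are counts of dimensions. The vectors `colVec E K A` for different `K ⊆ A` are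
orthogonal, so among the sets `K ⊆ J ⊆ A` of a given parity there is one for which `colVec E K A`
avoids a given line if `J` has two elements, or a given plane if `J` has three
(`exists_colVec_ne_smul`, `exists_colVec_ne_add`).

Let `T` be the block of the target. If it contains all the input bits, then at least two of them
are outside `S` or at least three in `S`, and either is impossible
(`not_targetAmp_eq_zero_of_four_le`). Otherwise, flipping an input bit `i ∉ T` changes the parity
but not the state of `T`, so the second gate must act on `T` before the flip and not after it, or
the other way round. So the test whether the qubits in `S \ T` are all `1` has a definite outcome,
which is, up to negation, the parity of the input bits outside `T`. That outcome is a conjunction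
over the blocks, so these inputs lie in one block, and that block computes the parity of at most
two bits in this way (`card_le_two_of_flip`). Fixing them so that the second gate does not act on
`T`, the block `T` computes the parity of its own inputs with one layer, so it has at most one
(`not_targetAmp_eq_zero_of_two_le`). Three inputs in all are possible, and this is how the circuit
for `n = 3` works: one input is in the block of the target, and the other two are in another
block.
-/

namespace QAC

/-! ### Product vectors -/

section
variable {Q : Type}

/-- The bit string with support `K`. -/
def bits [DecidableEq Q] (K : Finset Q) (j : Q) : Fin 2 := if j ∈ K then 1 else 0

/-- The product vector `⨂ j ∈ A, p j`, as a function of the values of all the qubits that depends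
only on those in `A`. In this form tensor products over disjoint sets are pointwise products. -/
def prodVec (p : Q → Fin 2 → ℂ) (A : Finset Q) : Vec Q := fun s => ∏ j ∈ A, p j (s j)

/-- The product vector whose factors are the columns of the matrices `E j` selected by the bit
string with support `K`. -/
def colVec [DecidableEq Q] (E : Q → Matrix (Fin 2) (Fin 2) ℂ) (K A : Finset Q) : Vec Q :=
  prodVec (fun j a => E j a (bits K j)) A

/-- All the qubits in `A` have value `1`. -/
def AllOnes (A : Finset Q) (s : Q → Fin 2) : Prop := ∀ j ∈ A, s j = 1

instance (A : Finset Q) (s : Q → Fin 2) : Decidable (AllOnes A s) :=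
  inferInstanceAs (Decidable (∀ j ∈ A, s j = 1))

lemma prodVec_congr {p : Q → Fin 2 → ℂ} {A : Finset Q} {s s' : Q → Fin 2}
    (h : ∀ j ∈ A, s j = s' j) : prodVec p A s = prodVec p A s' :=
  Finset.prod_congr rfl fun j hj => by rw [h j hj]

lemma allOnes_congr {A : Finset Q} {s s' : Q → Fin 2} (h : ∀ j ∈ A, s j = s' j) :
    AllOnes A s ↔ AllOnes A s' :=
  forall₂_congr fun j hj => by rw [h j hj]

/-- Let `v` and `w` depend only on the qubits in `A`. If `v` is a multiple of `w` away from the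
all-ones string of `A`, then it is a linear combination of `w` and the indicator of that string. -/
lemma exists_eq_add_indicator {A : Finset Q} {v w : Vec Q} {c : ℂ}
    (hv : ∀ s s', (∀ j ∈ A, s j = s' j) → v s = v s')
    (hw : ∀ s s', (∀ j ∈ A, s j = s' j) → w s = w s')
    (h : ∀ s, ¬ AllOnes A s → v s = c * w s) :
    ∃ d : ℂ, v = c • w + d • (fun s => if AllOnes A s then (1 : ℂ) else 0) := by
  refine ⟨v (fun _ => 1) - c * w (fun _ => 1), funext fun s => ?_⟩
  by_cases hs : AllOnes A s
  · rw [hv s (fun _ => 1) hs]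
    simp [hs, hw s (fun _ => 1) hs]
  · simp [hs, h s hs]

/-- A pairwise orthogonal family of nonzero vectors is linearly independent. -/
lemma linearIndependent_of_orthogonal {ι σ : Type*} [Fintype σ] (v : ι → σ → ℂ)
    (h0 : ∀ i, star (v i) ⬝ᵥ v i ≠ 0) (h : ∀ i j, i ≠ j → star (v i) ⬝ᵥ v j = 0) :
    LinearIndependent ℂ v := by
  classical
  rw [linearIndependent_iff']
  intro s c hc i hi
  have := congrArg (fun w => star (v i) ⬝ᵥ w) hc
  simp only [dotProduct_sum, dotProduct_smul, dotProduct_zero] at this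
  rw [Finset.sum_eq_single i (fun j _ hj => by rw [h i j hj.symm, smul_zero])
    (fun hn => absurd hi hn)] at this
  simpa [h0 i] using this

variable [DecidableEq Q]

lemma colVec_congr {E : Q → Matrix (Fin 2) (Fin 2) ℂ} {K K' A : Finset Q}
    (h : ∀ j ∈ A, (j ∈ K ↔ j ∈ K')) : colVec E K A = colVec E K' A := by
  funext s
  exact Finset.prod_congr rfl fun j hj => by simp only [bits, h j hj]

lemma prodVec_sdiff_mul (p : Q → Fin 2 → ℂ) {A B : Finset Q} (h : B ⊆ A) (s : Q → Fin 2) :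
    prodVec p A s = prodVec p B s * prodVec p (A \ B) s := by
  rw [mul_comm]; exact (Finset.prod_sdiff h).symm

lemma prodVec_piecewise_left (p : Q → Fin 2 → ℂ) (B : Finset Q) (s s' : Q → Fin 2) :
    prodVec p B (B.piecewise s s') = prodVec p B s :=
  prodVec_congr fun j hj => by simp [hj]

lemma prodVec_piecewise_right (p : Q → Fin 2 → ℂ) (A B : Finset Q) (s s' : Q → Fin 2) :
    prodVec p (A \ B) (B.piecewise s s') = prodVec p (A \ B) s' :=
  prodVec_congr fun j hj => by simp [(Finset.mem_sdiff.1 hj).2]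

lemma odd_add_card_symmDiff_singleton (b : ℕ) (K : Finset Q) (i : Q) :
    Odd (b + (symmDiff K {i}).card) ↔ ¬ Odd (b + K.card) := by
  by_cases hi : i ∈ K
  · have h : symmDiff K {i} = K.erase i := by
      ext j; by_cases hj : j = i <;> simp [Finset.mem_symmDiff, hj, hi]
    have h2 := Finset.card_erase_add_one hi
    rw [h, ← h2, ← add_assoc, Nat.odd_add_one, not_not]
  · have h : symmDiff K {i} = insert i K := by
      ext j; by_cases hj : j = i <;> simp [Finset.mem_symmDiff, hj, hi]
    rw [h, Finset.card_insert_of_notMem hi, ← add_assoc, Nat.odd_add_one]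

variable [Fintype Q]

lemma star_colVec_dotProduct (E : Q → Matrix.unitaryGroup (Fin 2) ℂ) (K K' A : Finset Q) :
    star (colVec (fun j => (E j).1) K A) ⬝ᵥ colVec (fun j => (E j).1) K' A =
      ∏ j, if j ∈ A then (if bits K j = bits K' j then 1 else 0) else (2 : ℂ) := by
  have key : ∀ s : Q → Fin 2,
      star (colVec (fun j => (E j).1) K A) s * colVec (fun j => (E j).1) K' A s =
        ∏ j, if j ∈ A then star ((E j).1 (s j) (bits K j)) * (E j).1 (s j) (bits K' j)
          else 1 := by
    intro s
    rw [Finset.prod_ite_mem, Finset.univ_inter, Finset.prod_mul_distrib]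
    simp [colVec, prodVec]
  simp only [dotProduct, key]
  rw [← Fintype.piFinset_univ, ← Finset.prod_univ_sum (fun _ => Finset.univ)
    (fun j a => if j ∈ A then star ((E j).1 a (bits K j)) * (E j).1 a (bits K' j) else (1 : ℂ))]
  refine Finset.prod_congr rfl fun j _ => ?_
  split_ifs with hj hb
  all_goals
    try
      have := congrFun (congrFun (Matrix.mem_unitaryGroup_iff'.1 (E j).2) (bits K j)) (bits K' j)
      rw [Matrix.mul_apply, Matrix.one_apply] at this
      simpa [hb, Matrix.star_apply] using this
  simp

lemma star_colVec_dotProduct_self_ne_zero (E : Q → Matrix.unitaryGroup (Fin 2) ℂ)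
    (K A : Finset Q) :
    star (colVec (fun j => (E j).1) K A) ⬝ᵥ colVec (fun j => (E j).1) K A ≠ 0 := by
  rw [star_colVec_dotProduct, Finset.prod_ne_zero_iff]
  intro j _
  split_ifs <;> simp_all

lemma exists_colVec_ne_zero (E : Q → Matrix.unitaryGroup (Fin 2) ℂ) (K A : Finset Q) :
    ∃ s, colVec (fun j => (E j).1) K A s ≠ 0 := by
  by_contra! h
  apply star_colVec_dotProduct_self_ne_zero E K A
  rw [funext h]
  simp [dotProduct]

lemma linearIndependent_colVec (E : Q → Matrix.unitaryGroup (Fin 2) ℂ) (A : Finset Q)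
    {ι : Type*} (K : ι → Finset Q) (hK : ∀ i, K i ⊆ A) (hinj : Function.Injective K) :
    LinearIndependent ℂ fun i => colVec (fun j => (E j).1) (K i) A := by
  refine linearIndependent_of_orthogonal _
    (fun i => star_colVec_dotProduct_self_ne_zero E (K i) A) fun i i' hi => ?_
  obtain ⟨j, hj⟩ : ∃ j, ¬ (j ∈ K i ↔ j ∈ K i') := by
    by_contra! h
    exact hi (hinj (Finset.ext h))
  rw [star_colVec_dotProduct, Finset.prod_eq_zero (Finset.mem_univ j)]
  have hA : j ∈ A := by
    by_contra hA
    exact hj ⟨fun h => absurd (hK i h) hA, fun h => absurd (hK i' h) hA⟩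
  rw [if_pos hA, if_neg]
  unfold bits
  split_ifs <;> simp_all

/-- The vectors `colVec E K A`, `K ⊆ J`, with `K` of a prescribed parity, span a space of dimension
at least `#J`: there are at least `#J` such sets `K`, and the vectors are orthogonal. -/
lemma exists_colVec_notMem_span (E : Q → Matrix.unitaryGroup (Fin 2) ℂ) {A J : Finset Q}
    (hJ : J ⊆ A) (W : Finset (Vec Q)) (hW : W.card < J.card) (b : ℕ) :
    ∃ K ⊆ J, Odd (b + K.card) ∧
      colVec (fun j => (E j).1) K A ∉ Submodule.span ℂ (W : Set (Vec Q)) := by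
  obtain ⟨j₀, hj₀⟩ : J.Nonempty := Finset.card_pos.1 (by omega)
  -- `j ↦ {j}` gives `#J` sets of odd size, and `j ↦ {j} ∆ {j₀}` gives `#J` sets of even size.
  obtain ⟨K, hKinj, hK⟩ : ∃ K : J → Finset Q, Function.Injective K ∧
      ∀ j, K j ⊆ J ∧ Odd (b + (K j).card) := by
    by_cases hb : Odd (b + 1)
    · exact ⟨fun j => {j.1}, fun j j' h => Subtype.ext (by simpa using h),
        fun j => ⟨by simp, by simpa using hb⟩⟩
    · refine ⟨fun j => symmDiff {j.1} {j₀}, fun j j' h => Subtype.ext ?_, fun j => ⟨?_, ?_⟩⟩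
      · simpa using symmDiff_left_injective _ h
      · intro i hi
        rcases Finset.mem_symmDiff.1 hi with h | h
        · rw [Finset.mem_singleton.1 h.1]; exact j.2
        · rwa [Finset.mem_singleton.1 h.1]
      · rw [odd_add_card_symmDiff_singleton]; simpa using hb
  by_contra! h
  have hli := linearIndependent_colVec E A K (fun j => (hK j).1.trans hJ) hKinj
  have := linearIndependent_le_span_aux' _ hli (W : Set (Vec Q))
    (by rintro _ ⟨j, rfl⟩; exact h _ (hK j).1 (hK j).2)
  simp at this
  omega

/-- The case of one vector `w` in `exists_colVec_notMem_span`. -/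
lemma exists_colVec_ne_smul (E : Q → Matrix.unitaryGroup (Fin 2) ℂ) {A J : Finset Q}
    (hJ : J ⊆ A) (hJ2 : 2 ≤ J.card) (w : Vec Q) (b : ℕ) :
    ∃ K ⊆ J, Odd (b + K.card) ∧ ∀ c : ℂ, colVec (fun j => (E j).1) K A ≠ c • w := by
  obtain ⟨K, hK, hb, h⟩ := exists_colVec_notMem_span E hJ {w}
    (by rw [Finset.card_singleton]; omega) b
  refine ⟨K, hK, hb, fun c hc => h ?_⟩
  rw [hc]
  exact Submodule.smul_mem _ _ (Submodule.subset_span (by simp))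

/-- The case of two vectors in `exists_colVec_notMem_span`. -/
lemma exists_colVec_ne_add (E : Q → Matrix.unitaryGroup (Fin 2) ℂ) {A J : Finset Q}
    (hJ : J ⊆ A) (hJ3 : 3 ≤ J.card) (v w : Vec Q) (b : ℕ) :
    ∃ K ⊆ J, Odd (b + K.card) ∧
      ∀ c d : ℂ, colVec (fun j => (E j).1) K A ≠ c • v + d • w := by
  classical
  obtain ⟨K, hK, hb, h⟩ := exists_colVec_notMem_span E hJ {v, w}
    (lt_of_le_of_lt Finset.card_le_two hJ3) b
  refine ⟨K, hK, hb, fun c d hc => h ?_⟩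
  rw [hc]
  exact Submodule.add_mem _ (Submodule.smul_mem _ _ (Submodule.subset_span (by simp)))
    (Submodule.smul_mem _ _ (Submodule.subset_span (by simp)))

/-- Of the two vectors `colVec E ∅ A` and `colVec E {i} A`, at most one is a multiple of `w`. -/
lemma exists_colVec_ne_smul_of_mem (E : Q → Matrix.unitaryGroup (Fin 2) ℂ) {A : Finset Q} {i : Q}
    (hi : i ∈ A) (w : Vec Q) :
    ∃ K ⊆ {i}, ∀ c : ℂ, colVec (fun j => (E j).1) K A ≠ c • w := by
  by_contra! h
  have hli := linearIndependent_colVec E A (fun K : ({i} : Finset Q).powerset => K.1)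
    (fun K => (Finset.mem_powerset.1 K.2).trans (by simpa using hi)) Subtype.val_injective
  have := linearIndependent_le_span_aux' _ hli {w} (by
    rintro _ ⟨K, rfl⟩
    obtain ⟨c, hc⟩ := h K.1 (Finset.mem_powerset.1 K.2)
    exact Submodule.mem_span_singleton.2 ⟨c, hc.symm⟩)
  simp only [Fintype.card_coe, Finset.card_powerset, Finset.card_singleton,
    Fintype.card_unique] at this
  omega

end
/-! ### One block of the first layer -/

section
variable {Q : Type}

lemma eq_zero_of_forall_sum_eq_zero (u : Matrix.unitaryGroup (Fin 2) ℂ) {x : Fin 2 → ℂ}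
    (h : ∀ b, ∑ a, u.1 b a * x a = 0) : x = 0 := by
  have h1 : u.1 *ᵥ x = 0 := funext h
  have h2 := congrArg (fun v => (star u.1) *ᵥ v) h1
  rwa [Matrix.mulVec_mulVec, Matrix.mem_unitaryGroup_iff'.1 u.2, Matrix.one_mulVec,
    Matrix.mulVec_zero] at h2

lemma exists_col_ne_zero (u : Matrix.unitaryGroup (Fin 2) ℂ) (i : Fin 2) : ∃ a, u.1 a i ≠ 0 := by
  by_contra! h
  have := congrFun (congrFun (Matrix.mem_unitaryGroup_iff'.1 u.2) i) i
  rw [Matrix.mul_apply] at this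
  simp [h] at this

lemma eq_zero_of_mul_eq_mul {v w : Vec Q} (h : ∀ c : ℂ, v ≠ c • w) {a b : ℂ}
    (hab : ∀ s, a * v s = b * w s) : a = 0 := by
  by_contra ha
  refine h (b / a) (funext fun s => ?_)
  have := hab s
  simp only [Pi.smul_apply, smul_eq_mul]
  field_simp
  linear_combination this

variable [DecidableEq Q]

/-- The state of the qubits in `T` after a first layer with the C-SIGN gate on `T`, started on the
input with support `K`, and the following single-qubit gates: a gate on a product state
subtracts a multiple of a product vector which does not depend on the input. -/
def blockVec (E : Q → Matrix (Fin 2) (Fin 2) ℂ) (g : Q → Fin 2 → ℂ) (κ : ℂ) (K T : Finset Q) :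
    Vec Q :=
  fun s => colVec E K T s - κ * prodVec g T s

/-- The row `b` of `u`, applied to the target qubit `t` of the vector that a C-SIGN gate on
`insert t A` makes of `ψ`. For `lam = 1` the gate is present, for `lam = 0` it is absent. -/
def targetAmp (u : Matrix (Fin 2) (Fin 2) ℂ) (A : Finset Q) (lam : ℂ) (t : Q) (ψ : Vec Q)
    (b : Fin 2) (s : Q → Fin 2) : ℂ :=
  ∑ a, u b a * (if a = 1 ∧ AllOnes A s then 1 - 2 * lam else 1) * ψ (Function.update s t a)

lemma blockVec_piecewise {E : Q → Matrix (Fin 2) (Fin 2) ℂ} {g : Q → Fin 2 → ℂ} {κ : ℂ}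
    {K T B : Finset Q} (hB : B ⊆ T) (s s' : Q → Fin 2) :
    blockVec E g κ K T (B.piecewise s s') =
      colVec E K B s * colVec E K (T \ B) s' - κ * (prodVec g B s * prodVec g (T \ B) s') := by
  simp only [blockVec, colVec, prodVec_sdiff_mul _ hB, prodVec_piecewise_left,
    prodVec_piecewise_right]

lemma prodVec_update (p : Q → Fin 2 → ℂ) {T : Finset Q} {t : Q} (ht : t ∈ T) (s : Q → Fin 2)
    (a : Fin 2) : prodVec p T (Function.update s t a) = p t a * prodVec p (T.erase t) s := by
  unfold prodVec
  rw [← Finset.mul_prod_erase _ _ ht]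
  congr 1
  · simp
  · exact Finset.prod_congr rfl fun j hj => by
      rw [Function.update_of_ne (Finset.ne_of_mem_erase hj)]

lemma targetAmp_blockVec {u : Matrix (Fin 2) (Fin 2) ℂ} {E : Q → Matrix (Fin 2) (Fin 2) ℂ}
    {g : Q → Fin 2 → ℂ} {κ lam : ℂ} {K T A : Finset Q} {t : Q} (ht : t ∈ T) (htK : t ∉ K)
    (b : Fin 2) (s : Q → Fin 2) :
    targetAmp u A lam t (blockVec E g κ K T) b s =
      (∑ a, u b a * (if a = 1 ∧ AllOnes A s then 1 - 2 * lam else 1) * E t a 0) *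
          colVec E K (T.erase t) s -
        κ * ((∑ a, u b a * (if a = 1 ∧ AllOnes A s then 1 - 2 * lam else 1) * g t a) *
          prodVec g (T.erase t) s) := by
  simp only [targetAmp, blockVec, colVec, prodVec_update _ ht, Fin.sum_univ_two, bits, htK,
    if_false]
  ring

variable [Fintype Q]

/-- If no C-SIGN gate follows on the target, then the block of the target does not compute the
parity of two bits: `colVec E K` is a multiple of a fixed vector for at most one `K`. -/
lemma not_targetAmp_eq_zero_of_two_le (E : Q → Matrix.unitaryGroup (Fin 2) ℂ)
    (u : Matrix.unitaryGroup (Fin 2) ℂ) (g : Q → Fin 2 → ℂ) (κ : Finset Q → ℂ) {T A J : Finset Q}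
    {t : Q} (ht : t ∈ T) (hJ : J ⊆ T.erase t) (hJ2 : 2 ≤ J.card) (c : ℕ)
    (h : ∀ K ⊆ J, ∀ b : Fin 2, Odd (b + c + K.card) → ∀ s,
      targetAmp u.1 A 0 t (blockVec (fun j => (E j).1) g (κ K) K T) b s = 0) : False := by
  obtain ⟨b, hb⟩ : ∃ b, ∑ a, u.1 b a * (E t).1 a 0 ≠ 0 := by
    by_contra! h0
    obtain ⟨a, ha⟩ := exists_col_ne_zero (E t) 0
    exact ha (congrFun (eq_zero_of_forall_sum_eq_zero u (x := fun a => (E t).1 a 0) h0) a)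
  obtain ⟨K, hK, hodd, hne⟩ := exists_colVec_ne_smul E hJ hJ2 (prodVec g (T.erase t)) (b + c)
  have htK : t ∉ K := fun h => by simpa using hJ (hK h)
  refine hb (eq_zero_of_mul_eq_mul hne (b := κ K * ∑ a, u.1 b a * g t a) fun s => ?_)
  have := h K hK b hodd s
  rw [targetAmp_blockVec ht htK] at this
  simp only [mul_zero, sub_zero, ite_self, mul_one] at this
  linear_combination this

/-- If all the inputs are in the block of the target, then the block does not compute the parity
of four bits. Of these bits, either two are outside the second gate or three are in it. In the
former case, flipping the two bits does not change the factor of the state on `insert t A`, while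
each parity annihilates one row of `u` on what the gate makes of this factor, which is not zero. In
the latter case, for some parity, the vectors `colVec E K A` for `K` of that parity lie in the plane
spanned by `prodVec g A` and the indicator of the all-ones string. -/
lemma not_targetAmp_eq_zero_of_four_le (E : Q → Matrix.unitaryGroup (Fin 2) ℂ)
    (u : Matrix.unitaryGroup (Fin 2) ℂ) (g : Q → Fin 2 → ℂ) (κ : Finset Q → ℂ) {T A J : Finset Q}
    {t : Q} {lam : ℂ} (hlam : 1 - 2 * lam ≠ 0) (ht : t ∈ T) (hA : A ⊆ T.erase t)
    (hJ : J ⊆ T.erase t) (hJ4 : 4 ≤ J.card)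
    (h : ∀ K ⊆ J, ∀ b : Fin 2, Odd (b + K.card) → ∀ s,
      targetAmp u.1 A lam t (blockVec (fun j => (E j).1) g (κ K) K T) b s = 0) : False := by
  set R := T.erase t with hR
  set W : (Fin 2 → ℂ) → Fin 2 → (Q → Fin 2) → ℂ := fun x b s =>
    ∑ a, u.1 b a * (if a = 1 ∧ AllOnes A s then 1 - 2 * lam else 1) * x a with hW
  have key : ∀ K ⊆ J, ∀ b : Fin 2, Odd (b + K.card) → ∀ s s',
      W (fun a => (E t).1 a 0) b s * (colVec (fun j => (E j).1) K A s *
        colVec (fun j => (E j).1) K (R \ A) s') =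
      κ K * (W (g t) b s * (prodVec g A s * prodVec g (R \ A) s')) := by
    intro K hK b hb s s'
    have htK : t ∉ K := fun h => by simpa [hR] using hJ (hK h)
    have := h K hK b hb (A.piecewise s s')
    have hones : AllOnes A (A.piecewise s s') ↔ AllOnes A s :=
      allOnes_congr fun j hj => by simp [hj]
    rw [targetAmp_blockVec ht htK, ← hR] at this
    simp only [hones, colVec, prodVec_sdiff_mul _ hA, prodVec_piecewise_left,
      prodVec_piecewise_right] at this ⊢
    simp only [hW]
    linear_combination this
  have hWne : ∀ s, ∃ b, W (fun a => (E t).1 a 0) b s ≠ 0 := by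
    intro s
    by_contra! h0
    obtain ⟨a, ha⟩ := exists_col_ne_zero (E t) 0
    have := congrFun (eq_zero_of_forall_sum_eq_zero u (x := fun a =>
      (if a = 1 ∧ AllOnes A s then 1 - 2 * lam else 1) * (E t).1 a 0)
      (fun b => by simpa only [hW, mul_assoc] using h0 b)) a
    simp only [Pi.zero_apply, mul_eq_zero, ha, or_false] at this
    split_ifs at this <;> simp_all
  have hcard := Finset.card_sdiff_add_card_inter J A
  by_cases h2 : 2 ≤ (J \ A).card
  · have hsub : J \ A ⊆ R \ A := Finset.sdiff_subset_sdiff hJ le_rfl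
    obtain ⟨s, hs⟩ := exists_colVec_ne_zero E ∅ A
    obtain ⟨b, hb⟩ := hWne s
    obtain ⟨K, hK, hodd, hne⟩ := exists_colVec_ne_smul E hsub h2 (prodVec g (R \ A)) b
    have hA0 : colVec (fun j => (E j).1) K A = colVec (fun j => (E j).1) ∅ A :=
      colVec_congr fun j hj => by
        simpa using fun h => (Finset.mem_sdiff.1 (hK h)).2 hj
    refine mul_ne_zero hb hs (eq_zero_of_mul_eq_mul hne
      (b := κ K * (W (g t) b s * prodVec g A s)) fun s' => ?_)
    have := key K (hK.trans Finset.sdiff_subset) b hodd s s'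
    rw [hA0] at this
    linear_combination this
  · have h3 : 3 ≤ (J ∩ A).card := by omega
    obtain ⟨s', hs'⟩ := exists_colVec_ne_zero E ∅ (R \ A)
    obtain ⟨b, hb⟩ : ∃ b, ∑ a, u.1 b a * (E t).1 a 0 ≠ 0 := by
      by_contra! h0
      obtain ⟨a, ha⟩ := exists_col_ne_zero (E t) 0
      exact ha (congrFun (eq_zero_of_forall_sum_eq_zero u (x := fun a => (E t).1 a 0) h0) a)
    obtain ⟨K, hK, hodd, hne⟩ := exists_colVec_ne_add E (A := A) (J := J ∩ A)
      Finset.inter_subset_right h3 (prodVec g A)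
      (fun s => if AllOnes A s then (1 : ℂ) else 0) b
    have hD0 : colVec (fun j => (E j).1) K (R \ A) = colVec (fun j => (E j).1) ∅ (R \ A) :=
      colVec_congr fun j hj => by
        simpa using fun h => (Finset.mem_sdiff.1 hj).2 (Finset.mem_inter.1 (hK h)).2
    obtain ⟨d, hd⟩ := exists_eq_add_indicator (A := A) (v := colVec (fun j => (E j).1) K A)
      (w := prodVec g A) (c := κ K * (∑ a, u.1 b a * g t a) * prodVec g (R \ A) s' /
        ((∑ a, u.1 b a * (E t).1 a 0) * colVec (fun j => (E j).1) ∅ (R \ A) s'))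
      (fun s s' h => prodVec_congr h) (fun s s' h => prodVec_congr h) (fun s hs => by
        have := key K (hK.trans Finset.inter_subset_left) b hodd s s'
        simp only [hW, hs, and_false, if_false, mul_one, hD0] at this
        field_simp
        linear_combination this)
    exact hne _ _ hd

/-- For three bits of a block, their parity is not the outcome of the test whether all the qubits in
`B` are `1`. Either two of the bits are outside `B`, or all three are in `B`, or there is one bit
outside `B` and there are two in `B`. -/
lemma not_forall_blockVec_ne_zero_iff (E : Q → Matrix.unitaryGroup (Fin 2) ℂ)
    (g : Q → Fin 2 → ℂ) (κ : Finset Q → ℂ) {T B J : Finset Q} (hB : B ⊆ T) (hJ : J ⊆ T)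
    (hJ3 : 3 ≤ J.card) (c : ℕ)
    (h : ∀ K ⊆ J, ∀ s, blockVec (fun j => (E j).1) g (κ K) K T s ≠ 0 →
      (AllOnes B s ↔ Odd (c + K.card))) : False := by
  have key : ∀ K ⊆ J, ∀ s s', ¬ (AllOnes B s ↔ Odd (c + K.card)) →
      colVec (fun j => (E j).1) K B s * colVec (fun j => (E j).1) K (T \ B) s' =
        κ K * (prodVec g B s * prodVec g (T \ B) s') := by
    intro K hK s s' hs
    by_contra hne
    apply hs
    rw [← allOnes_congr (s := B.piecewise s s') (s' := s) (fun j hj => by simp [hj])]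
    refine h K hK _ ?_
    rw [blockVec_piecewise hB]
    exact sub_ne_zero.2 hne
  have hcard := Finset.card_sdiff_add_card_inter J B
  have hsub : J \ B ⊆ T \ B := Finset.sdiff_subset_sdiff hJ le_rfl
  by_cases h2 : 2 ≤ (J \ B).card
  · -- Flipping bits outside `B` leaves `colVec E ∅ B` as it is. At any string `s` one of the two
    -- parities excludes the value of `AllOnes B s`, so that this vector would vanish at `s`.
    obtain ⟨s, hs⟩ := exists_colVec_ne_zero E ∅ B
    obtain ⟨K, hK, hodd, hne⟩ := exists_colVec_ne_smul E hsub h2 (prodVec g (T \ B))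
      (c + if AllOnes B s then 1 else 0)
    have hB0 : colVec (fun j => (E j).1) K B = colVec (fun j => (E j).1) ∅ B :=
      colVec_congr fun j hj => by
        simpa using fun h => (Finset.mem_sdiff.1 (hK h)).2 hj
    refine hs (eq_zero_of_mul_eq_mul hne (b := κ K * prodVec g B s) fun s' => ?_)
    have := key K (hK.trans Finset.sdiff_subset) s s' (by
      split_ifs at hodd with hs1
      · rw [add_right_comm, Nat.odd_add_one] at hodd
        tauto
      · tauto)
    rw [hB0] at this
    linear_combination this
  by_cases h3 : 3 ≤ (J ∩ B).card
  · obtain ⟨s', hs'⟩ := exists_colVec_ne_zero E ∅ (T \ B)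
    obtain ⟨K, hK, hodd, hne⟩ := exists_colVec_ne_add E (A := B) (J := J ∩ B)
      Finset.inter_subset_right h3 (prodVec g B)
      (fun s => if AllOnes B s then (1 : ℂ) else 0) c
    have hD0 : colVec (fun j => (E j).1) K (T \ B) = colVec (fun j => (E j).1) ∅ (T \ B) :=
      colVec_congr fun j hj => by
        simpa using fun h => (Finset.mem_sdiff.1 hj).2 (Finset.mem_inter.1 (hK h)).2
    obtain ⟨d, hd⟩ := exists_eq_add_indicator (A := B) (v := colVec (fun j => (E j).1) K B)
      (w := prodVec g B) (c := κ K * prodVec g (T \ B) s' /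
        colVec (fun j => (E j).1) ∅ (T \ B) s')
      (fun s s' h => prodVec_congr h) (fun s s' h => prodVec_congr h) (fun s hs => by
        have := key K (hK.trans Finset.inter_subset_left) s s' (by tauto)
        rw [hD0] at this
        field_simp
        linear_combination this)
    exact hne _ _ hd
  · -- One value of a bit outside `B` makes the factor on `T \ B` independent of the gate's
    -- correction. The bits in `B` then send two inputs of the same parity to the all-ones string.
    obtain ⟨i, hi⟩ : (J \ B).Nonempty := Finset.card_pos.1 (by omega)
    obtain ⟨L, hL, hneL⟩ := exists_colVec_ne_smul_of_mem E (hsub hi) (prodVec g (T \ B))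
    obtain ⟨K, hK, hodd, hneK⟩ := exists_colVec_ne_smul E (A := B) (J := J ∩ B)
      Finset.inter_subset_right (by omega)
      (fun s => if AllOnes B s then (1 : ℂ) else 0) (c + L.card)
    have hiB := (Finset.mem_sdiff.1 hi).2
    have hLB : ∀ j ∈ L, j ∉ B := fun j hj => by
      rw [Finset.mem_singleton.1 (hL hj)]; exact hiB
    have hKB : ∀ j ∈ K, j ∈ B := fun j hj => (Finset.mem_inter.1 (hK hj)).2
    have hdisj : Disjoint L K := Finset.disjoint_left.2 fun j hj hj' => hLB j hj (hKB j hj')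
    have hLK : L ∪ K ⊆ J := Finset.union_subset
      (hL.trans (by simpa using (Finset.mem_sdiff.1 hi).1)) (hK.trans Finset.inter_subset_left)
    have h1 : colVec (fun j => (E j).1) (L ∪ K) B = colVec (fun j => (E j).1) K B :=
      colVec_congr fun j hj => by
        simpa using fun h => absurd hj (hLB j h)
    have h1' : colVec (fun j => (E j).1) (L ∪ K) (T \ B) = colVec (fun j => (E j).1) L (T \ B) :=
      colVec_congr fun j hj => by
        simpa using fun h => absurd (hKB j h) (Finset.mem_sdiff.1 hj).2
    obtain ⟨d, hd⟩ := exists_eq_add_indicator (A := B) (v := colVec (fun j => (E j).1) K B)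
      (w := 0) (c := 0)
      (fun s s' h => prodVec_congr h) (fun s s' h => rfl) (fun s hs => by
        rw [zero_mul]
        refine eq_zero_of_mul_eq_mul hneL (b := κ (L ∪ K) * prodVec g B s) fun s' => ?_
        have := key (L ∪ K) hLK s s' (by
          rw [Finset.card_union_of_disjoint hdisj, ← add_assoc]; tauto)
        rw [h1, h1'] at this
        linear_combination this)
    rw [smul_zero, zero_add] at hd
    exact hneK _ hd

end
/-! ### Combining the blocks -/

section
variable {Q : Type} [DecidableEq Q]

/-- The product of the states of the blocks in `𝒯`. The scalar `κ T K` is that of the block `T` on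
the input with support `K`. -/
def blocksVec (E : Q → Matrix (Fin 2) (Fin 2) ℂ) (g : Q → Fin 2 → ℂ)
    (κ : Finset Q → Finset Q → ℂ) (𝒯 : Finset (Finset Q)) (K : Finset Q) : Vec Q :=
  fun s => ∏ T ∈ 𝒯, blockVec E g (κ T K) K T s

variable {E : Q → Matrix (Fin 2) (Fin 2) ℂ} {g : Q → Fin 2 → ℂ} {κ : Finset Q → Finset Q → ℂ}

lemma blockVec_congr (hκ : ∀ T K K', (∀ j ∈ T, (j ∈ K ↔ j ∈ K')) → κ T K = κ T K')
    {T K K' : Finset Q} (h : ∀ j ∈ T, (j ∈ K ↔ j ∈ K')) :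
    blockVec E g (κ T K) K T = blockVec E g (κ T K') K' T := by
  unfold blockVec
  rw [hκ T K K' h, colVec_congr h]

lemma blocksVec_congr (hκ : ∀ T K K', (∀ j ∈ T, (j ∈ K ↔ j ∈ K')) → κ T K = κ T K')
    {𝒯 : Finset (Finset Q)} {K K' : Finset Q} (h : ∀ T ∈ 𝒯, ∀ j ∈ T, (j ∈ K ↔ j ∈ K')) :
    blocksVec E g κ 𝒯 K = blocksVec E g κ 𝒯 K' :=
  funext fun _ => Finset.prod_congr rfl fun T hT => by rw [blockVec_congr hκ (h T hT)]

lemma blockVec_congr_right {c : ℂ} {K T : Finset Q} {s s' : Q → Fin 2}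
    (h : ∀ j ∈ T, s j = s' j) : blockVec E g c K T s = blockVec E g c K T s' := by
  unfold blockVec colVec
  rw [prodVec_congr h, prodVec_congr h]

lemma blocksVec_congr_right {𝒯 : Finset (Finset Q)} {K : Finset Q} {s s' : Q → Fin 2}
    (h : ∀ T ∈ 𝒯, ∀ j ∈ T, s j = s' j) : blocksVec E g κ 𝒯 K s = blocksVec E g κ 𝒯 K s' :=
  Finset.prod_congr rfl fun T hT => blockVec_congr_right (h T hT)

lemma blocksVec_eq_mul_erase {𝒯 : Finset (Finset Q)} {T : Finset Q} (hT : T ∈ 𝒯) (K : Finset Q)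
    (s : Q → Fin 2) : blocksVec E g κ 𝒯 K s =
      blockVec E g (κ T K) K T s * blocksVec E g κ (𝒯.erase T) K s :=
  (Finset.mul_prod_erase _ _ hT).symm

/-- The amplitudes of pairwise disjoint blocks at a string that is `s` on the block `T` and `s'`
elsewhere. -/
lemma blocksVec_piecewise {𝒯 : Finset (Finset Q)} {T : Finset Q} (hT : T ∈ 𝒯)
    (hd : ∀ T' ∈ 𝒯.erase T, Disjoint T T') (K : Finset Q) (s s' : Q → Fin 2) :
    blocksVec E g κ 𝒯 K (T.piecewise s s') =
      blockVec E g (κ T K) K T s * blocksVec E g κ (𝒯.erase T) K s' := by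
  rw [blocksVec_eq_mul_erase hT]
  congr 1
  · exact blockVec_congr_right fun j hj => by simp [hj]
  · exact blocksVec_congr_right fun T' hT' j hj => by
      simp [Finset.disjoint_right.1 (hd T' hT') hj]

lemma allOnes_piecewise (S T : Finset Q) (s s' : Q → Fin 2) :
    AllOnes S (T.piecewise s s') ↔ AllOnes (S ∩ T) s ∧ AllOnes (S \ T) s' := by
  constructor
  · refine fun h => ⟨fun j hj => ?_, fun j hj => ?_⟩
    · simpa [(Finset.mem_inter.1 hj).2] using h j (Finset.mem_inter.1 hj).1
    · simpa [(Finset.mem_sdiff.1 hj).2] using h j (Finset.mem_sdiff.1 hj).1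
  · rintro ⟨h1, h2⟩ j hj
    by_cases hjT : j ∈ T
    · simpa [hjT] using h1 j (Finset.mem_inter.2 ⟨hj, hjT⟩)
    · simpa [hjT] using h2 j (Finset.mem_sdiff.2 ⟨hj, hjT⟩)

/-- If every flip of an element of `J` flips the predicate `p`, then `p` is a parity. -/
lemma exists_iff_odd_of_flip {J : Finset Q} {p : Finset Q → Prop}
    (h : ∀ K ⊆ J, ∀ i ∈ J, i ∉ K → (p (insert i K) ↔ ¬ p K)) :
    ∃ c : ℕ, ∀ K ⊆ J, (p K ↔ Odd (c + K.card)) := by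
  classical
  refine ⟨if p ∅ then 1 else 0, fun K => ?_⟩
  induction K using Finset.induction_on with
  | empty => intro _; split_ifs with h0 <;> simp [h0]
  | insert i K hi ih =>
    intro hK
    rw [h K ((Finset.subset_insert _ _).trans hK) i (hK (Finset.mem_insert_self _ _)) hi,
      ih ((Finset.subset_insert _ _).trans hK), Finset.card_insert_of_notMem hi, ← add_assoc,
      Nat.odd_add_one]

end

section
variable {Q : Type} [DecidableEq Q] [Fintype Q]

/-- If, for the blocks in `𝒯`, the test whether all the qubits in `B` are `1` has a definite outcome
for every input, and every flip of a bit in `J` flips that outcome, then `J` has at most two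
elements: the outcome is a conjunction over the blocks, so that `J` is contained in one block. -/
lemma card_le_two_of_flip {𝒯 : Finset (Finset Q)}
    (hdisj : (𝒯 : Set (Finset Q)).PairwiseDisjoint id)
    (E : Q → Matrix.unitaryGroup (Fin 2) ℂ) (g : Q → Fin 2 → ℂ) (κ : Finset Q → Finset Q → ℂ)
    (hκ : ∀ T K K', (∀ j ∈ T, (j ∈ K ↔ j ∈ K')) → κ T K = κ T K') {J B : Finset Q}
    (hcov : ∀ j ∈ J, ∃ T ∈ 𝒯, j ∈ T)
    (hne : ∀ K ⊆ J, ∃ s, blocksVec (fun j => (E j).1) g κ 𝒯 K s ≠ 0) (c : ℕ)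
    (h : ∀ K ⊆ J, ∀ s, blocksVec (fun j => (E j).1) g κ 𝒯 K s ≠ 0 →
      (AllOnes B s ↔ Odd (c + K.card))) : J.card ≤ 2 := by
  by_contra! hJ
  obtain ⟨i, hi⟩ : J.Nonempty := Finset.card_pos.1 (by omega)
  obtain ⟨T, hT, hiT⟩ := hcov i hi
  have hd : ∀ T' ∈ 𝒯.erase T, Disjoint T T' := fun T' hT' =>
    hdisj hT (Finset.mem_of_mem_erase hT') (Finset.ne_of_mem_erase hT').symm
  set σ : Finset Q → Vec Q := fun K => blockVec (fun j => (E j).1) g (κ T K) K T with hσ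
  set τ : Finset Q → Vec Q := fun K => blocksVec (fun j => (E j).1) g κ (𝒯.erase T) K with hτ
  have hmix : ∀ K s s', blocksVec (fun j => (E j).1) g κ 𝒯 K (T.piecewise s s') = σ K s * τ K s' :=
    fun K s s' => blocksVec_piecewise hT hd K s s'
  have hστ : ∀ K ⊆ J, ∃ s, σ K s ≠ 0 ∧ τ K s ≠ 0 := fun K hK => by
    obtain ⟨s, hs⟩ := hne K hK
    rw [blocksVec_eq_mul_erase hT] at hs
    exact ⟨s, left_ne_zero_of_mul hs, right_ne_zero_of_mul hs⟩
  have hσc : ∀ K K', (∀ j ∈ T, (j ∈ K ↔ j ∈ K')) → σ K = σ K' := fun K K' hK =>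
    blockVec_congr hκ hK
  have hτc : ∀ K K', (∀ j ∉ T, (j ∈ K ↔ j ∈ K')) → τ K = τ K' := fun K K' hK =>
    blocksVec_congr hκ fun T' hT' j hj => hK j (Finset.disjoint_right.1 (hd T' hT') hj)
  have hB : ∀ K ⊆ J, ∀ s s', σ K s ≠ 0 → τ K s' ≠ 0 →
      ((AllOnes (B ∩ T) s ∧ AllOnes (B \ T) s') ↔ Odd (c + K.card)) := fun K hK s s' h1 h2 => by
    rw [← allOnes_piecewise]
    exact h K hK _ (by rw [hmix]; exact mul_ne_zero h1 h2)
  have hJT : J ⊆ T := by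
    by_contra hJT
    obtain ⟨i', hi', hi'T⟩ := Finset.not_subset.1 hJT
    have hii' : i ≠ i' := fun h => hi'T (h ▸ hiT)
    have h1 : ({i} : Finset Q) ⊆ J := by simpa using hi
    have h2 : ({i'} : Finset Q) ⊆ J := by simpa using hi'
    have h12 : ({i, i'} : Finset Q) ⊆ J := Finset.insert_subset hi h2
    obtain ⟨s, hs, hs'⟩ := hστ ∅ (Finset.empty_subset _)
    obtain ⟨r, hr, hr'⟩ := hστ {i, i'} h12
    have e1 : σ {i} = σ {i, i'} := hσc _ _ fun j hj => by
      have : j ≠ i' := fun h => hi'T (h ▸ hj)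
      simp [this]
    have e2 : σ {i'} = σ ∅ := hσc _ _ fun j hj => by
      have : j ≠ i' := fun h => hi'T (h ▸ hj)
      simp [this]
    have e3 : τ {i} = τ ∅ := hτc _ _ fun j hj => by
      have : j ≠ i := fun h => hj (h ▸ hiT)
      simp [this]
    have e4 : τ {i'} = τ {i, i'} := hτc _ _ fun j hj => by
      have : j ≠ i := fun h => hj (h ▸ hiT)
      simp [this]
    have f0 := hB ∅ (Finset.empty_subset _) s s hs hs'
    have f12 := hB {i, i'} h12 r r hr hr'
    have f1 := hB {i} h1 r s (by rwa [e1]) (by rwa [e3])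
    have f2 := hB {i'} h2 s r (by rwa [e2]) (by rwa [e4])
    rw [Finset.card_pair hii', show c + 2 = c + 1 + 1 from rfl, Nat.odd_add_one,
      Nat.odd_add_one] at f12
    rw [Finset.card_singleton, Nat.odd_add_one] at f1 f2
    rw [Finset.card_empty, add_zero] at f0
    tauto
  have hτ0 : ∀ K ⊆ J, τ K = τ ∅ := fun K hK => hτc _ _ fun j hj => by
    simpa using fun h => hj (hJT (hK h))
  obtain ⟨s', -, hs'⟩ := hστ ∅ (Finset.empty_subset _)
  -- Some input passes the test, so `s'` passes its part outside `T`.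
  have hBT : AllOnes (B \ T) s' := by
    have h1 : ({i} : Finset Q) ⊆ J := by simpa using hi
    obtain ⟨s, hs, -⟩ := hστ ∅ (Finset.empty_subset _)
    obtain ⟨r, hr, -⟩ := hστ {i} h1
    have f0 := hB ∅ (Finset.empty_subset _) s s' hs hs'
    have f1 := hB {i} h1 r s' hr (by rwa [hτ0 _ h1])
    rw [Finset.card_singleton, Nat.odd_add_one] at f1
    rw [Finset.card_empty, add_zero] at f0
    tauto
  refine not_forall_blockVec_ne_zero_iff E g (κ T) (Finset.inter_subset_right (s₁ := B)) hJT hJ c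
    fun K hK s hs => ?_
  rw [← hB K hK s s' hs (by rwa [hτ0 _ hK])]
  tauto

/-- The impossibility result in terms of the state after the first layer, which is a product over
blocks: no gate of the second layer on the target `t` turns it into a state whose target computes
the parity of four bits. -/
lemma not_targetAmp_blocksVec_eq_zero {𝒯 : Finset (Finset Q)}
    (hdisj : (𝒯 : Set (Finset Q)).PairwiseDisjoint id) (hcov : ∀ j, ∃ T ∈ 𝒯, j ∈ T)
    (E : Q → Matrix.unitaryGroup (Fin 2) ℂ) (u : Matrix.unitaryGroup (Fin 2) ℂ)
    (g : Q → Fin 2 → ℂ) (κ : Finset Q → Finset Q → ℂ)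
    (hκ : ∀ T K K', (∀ j ∈ T, (j ∈ K ↔ j ∈ K')) → κ T K = κ T K') {S I : Finset Q} {t : Q}
    {lam : ℂ} (hlam : lam = 0 ∨ lam = 1) (htI : t ∉ I) (hI : 4 ≤ I.card)
    (hne : ∀ K ⊆ I, ∃ s, blocksVec (fun j => (E j).1) g κ 𝒯 K s ≠ 0)
    (h : ∀ K ⊆ I, ∀ b : Fin 2, Odd (b + K.card) → ∀ s,
      targetAmp u.1 (S.erase t) lam t (blocksVec (fun j => (E j).1) g κ 𝒯 K) b s = 0) :
    False := by
  obtain ⟨T, hT, htT⟩ := hcov t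
  have hd : ∀ T' ∈ 𝒯.erase T, Disjoint T T' := fun T' hT' =>
    hdisj hT (Finset.mem_of_mem_erase hT') (Finset.ne_of_mem_erase hT').symm
  set ξ : Finset Q → Vec Q := fun K => blockVec (fun j => (E j).1) g (κ T K) K T with hξ
  set η : Finset Q → Vec Q := fun K => blocksVec (fun j => (E j).1) g κ (𝒯.erase T) K with hη
  set A := S.erase t ∩ T with hA
  set B := S.erase t \ T with hB
  have hξη : ∀ K ⊆ I, ∃ s, ξ K s ≠ 0 ∧ η K s ≠ 0 := fun K hK => by
    obtain ⟨s, hs⟩ := hne K hK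
    rw [blocksVec_eq_mul_erase hT] at hs
    exact ⟨s, left_ne_zero_of_mul hs, right_ne_zero_of_mul hs⟩
  have hξc : ∀ K K', (∀ j ∈ T, (j ∈ K ↔ j ∈ K')) → ξ K = ξ K' := fun K K' hK =>
    blockVec_congr hκ hK
  have hηc : ∀ K K', (∀ j ∉ T, (j ∈ K ↔ j ∈ K')) → η K = η K' := fun K K' hK =>
    blocksVec_congr hκ fun T' hT' j hj => hK j (Finset.disjoint_right.1 (hd T' hT') hj)
  -- A basis state `s'` of the other blocks decides whether the second gate acts on the target's
  -- block.
  have hsep : ∀ K ⊆ I, ∀ b : Fin 2, Odd (b + K.card) → ∀ s', η K s' ≠ 0 → ∀ s,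
      targetAmp u.1 A (if AllOnes B s' then lam else 0) t (ξ K) b s = 0 := by
    intro K hK b hb s' hs' s
    have h0 := h K hK b hb (T.piecewise s s')
    have hup : ∀ a, Function.update (T.piecewise s s') t a =
        T.piecewise (Function.update s t a) s' := fun a => by
      funext j
      by_cases hj : j = t
      · subst hj; simp [htT]
      · by_cases hjT : j ∈ T <;> simp [hj, hjT]
    have hc : ∀ a : Fin 2, (if a = 1 ∧ AllOnes (S.erase t) (T.piecewise s s') then 1 - 2 * lam
        else 1) = if a = 1 ∧ AllOnes A s then 1 - 2 * (if AllOnes B s' then lam else 0) else 1 := by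
      intro a
      simp only [allOnes_piecewise, ← hA, ← hB]
      by_cases h1 : AllOnes A s <;> by_cases h2 : AllOnes B s' <;> simp [h1, h2]
    simp only [targetAmp, hc, hup, blocksVec_piecewise hT hd, ← mul_assoc] at h0
    rw [← Finset.sum_mul] at h0
    exact (mul_eq_zero.1 h0).resolve_right hs'
  have hlam' : ∀ s', 1 - 2 * (if AllOnes B s' then lam else 0) ≠ 0 := fun s' => by
    rcases hlam with rfl | rfl <;> split_ifs <;> norm_num
  have hIT : ∀ {J : Finset Q}, J ⊆ I → J ⊆ T → J ⊆ T.erase t := fun h1 h2 j hj =>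
    Finset.mem_erase.2 ⟨fun hjt => htI (hjt ▸ h1 hj), h2 hj⟩
  by_cases hall : I ⊆ T
  · obtain ⟨s', -, hs'⟩ := hξη ∅ (Finset.empty_subset _)
    refine not_targetAmp_eq_zero_of_four_le E u g (κ T) (hlam' s') htT (A := A) ?_
      (hIT le_rfl hall) hI fun K hK b hb s => hsep K hK b hb s' ?_ s
    · exact fun j hj => Finset.mem_erase.2 ⟨Finset.ne_of_mem_erase (Finset.mem_inter.1 hj).1,
        (Finset.mem_inter.1 hj).2⟩
    · rwa [hηc K ∅ fun j hj => by simpa using fun h => hj (hall (hK h))]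
  -- Flipping a bit outside `T` changes the parity but not `ξ`, so the second gate must act on one
  -- of the two inputs and not on the other.
  have hflip : ∀ K ⊆ I, ∀ i ∈ I, i ∉ T → i ∉ K → ∀ s s', η K s ≠ 0 → η (insert i K) s' ≠ 0 →
      (AllOnes B s' ↔ ¬ AllOnes B s) := by
    intro K hK i hi hiT hiK s s' hs hs'
    by_contra hcon
    have hiff : AllOnes B s' ↔ AllOnes B s := by tauto
    have hK' : insert i K ⊆ I := Finset.insert_subset hi hK
    have hξ' : ξ (insert i K) = ξ K := hξc _ _ fun j hj => by
      have : j ≠ i := fun h => hiT (h ▸ hj)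
      simp [this]
    obtain ⟨r, hr, -⟩ := hξη K hK
    refine hr ?_
    have hzero : ∀ b : Fin 2,
        targetAmp u.1 A (if AllOnes B s then lam else 0) t (ξ K) b r = 0 := by
      intro b
      by_cases hb : Odd (b + K.card)
      · exact hsep K hK b hb s hs r
      · have := hsep (insert i K) hK' b (by
          rwa [Finset.card_insert_of_notMem hiK, ← add_assoc, Nat.odd_add_one]) s' hs' r
        simpa only [hiff, hξ'] using this
    have := congrFun (eq_zero_of_forall_sum_eq_zero u (x := fun a =>
      (if a = 1 ∧ AllOnes A r then 1 - 2 * (if AllOnes B s then lam else 0) else 1) *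
        ξ K (Function.update r t a)) (fun b => by simpa only [targetAmp, mul_assoc] using hzero b))
        (r t)
    simp only [Pi.zero_apply, Function.update_eq_self] at this
    refine (mul_eq_zero.1 this).resolve_left ?_
    split_ifs with h1 h2
    · simpa [h2] using hlam' s
    · simp
    · simp
  obtain ⟨i, hi, hiT⟩ := Finset.not_subset.1 hall
  set J := I \ T with hJ
  have hJI : J ⊆ I := Finset.sdiff_subset
  have hJT : ∀ j ∈ J, j ∉ T := fun j hj => (Finset.mem_sdiff.1 hj).2
  have hiJ : i ∈ J := Finset.mem_sdiff.2 ⟨hi, hiT⟩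
  have hdef : ∀ K ⊆ J, ∀ s s', η K s ≠ 0 → η K s' ≠ 0 → (AllOnes B s ↔ AllOnes B s') := by
    intro K hK s s' hs hs'
    by_cases hiK : i ∈ K
    · have hins : insert i (K.erase i) = K := Finset.insert_erase hiK
      have hKe : K.erase i ⊆ I := (Finset.erase_subset _ _).trans (hK.trans hJI)
      obtain ⟨r, -, hr⟩ := hξη _ hKe
      have h1 := hflip _ hKe i hi hiT (Finset.notMem_erase _ _) r s hr (by rwa [hins])
      have h2 := hflip _ hKe i hi hiT (Finset.notMem_erase _ _) r s' hr (by rwa [hins])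
      tauto
    · obtain ⟨r, -, hr⟩ := hξη _ (Finset.insert_subset hi (hK.trans hJI))
      have h1 := hflip K (hK.trans hJI) i hi hiT hiK s r hs hr
      have h2 := hflip K (hK.trans hJI) i hi hiT hiK s' r hs' hr
      tauto
  obtain ⟨c, hc⟩ := exists_iff_odd_of_flip (J := J)
    (p := fun K => ∀ s, η K s ≠ 0 → AllOnes B s) (by
      intro K hK j hj hjK
      obtain ⟨s, -, hs⟩ := hξη K (hK.trans hJI)
      obtain ⟨s', -, hs'⟩ := hξη _ (Finset.insert_subset (hJI hj) (hK.trans hJI))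
      have hf := hflip K (hK.trans hJI) j (hJI hj) (hJT j hj) hjK s s' hs hs'
      have hK' : insert j K ⊆ J := Finset.insert_subset hj hK
      constructor
      · exact fun hp hp' => hf.1 (hp s' hs') (hp' s hs)
      · intro hp r hr
        rw [hdef _ hK' r s' hr hs', hf]
        exact fun hs1 => hp fun r' hr' => (hdef K hK r' s hr' hs).2 hs1)
  have hc' : ∀ K ⊆ J, ∀ s, η K s ≠ 0 → (AllOnes B s ↔ Odd (c + K.card)) := by
    intro K hK s hs
    rw [← hc K hK]
    exact ⟨fun h s' hs' => (hdef K hK s' s hs' hs).2 h, fun h => h s hs⟩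
  have hJcard : J.card ≤ 2 := by
    refine card_le_two_of_flip (𝒯 := 𝒯.erase T) (hdisj.subset (by simp)) E g κ hκ
      (fun j hj => ?_) (fun K hK => ?_) c hc'
    · obtain ⟨T', hT', hjT'⟩ := hcov j
      exact ⟨T', Finset.mem_erase.2 ⟨fun h => hJT j hj (h ▸ hjT'), hT'⟩, hjT'⟩
    · obtain ⟨s, -, hs⟩ := hξη K (hK.trans hJI)
      exact ⟨s, hs⟩
  have hcard := Finset.card_sdiff_add_card_inter I T
  rw [← hJ] at hcard
  -- Fix the bits outside `T` so that the second gate does not act on the target's block.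
  obtain ⟨L, hL, hLodd⟩ : ∃ L ⊆ J, ¬ Odd (c + L.card) := by
    by_cases h0 : Odd (c + (∅ : Finset Q).card)
    · exact ⟨{i}, by simpa using hiJ, by
        rw [Finset.card_singleton, Nat.odd_add_one, not_not]; simpa using h0⟩
    · exact ⟨∅, Finset.empty_subset _, h0⟩
  obtain ⟨s', -, hs'⟩ := hξη L (hL.trans hJI)
  have hBs' : ¬ AllOnes B s' := fun h => hLodd ((hc' L hL s' hs').1 h)
  refine not_targetAmp_eq_zero_of_two_le E u g (κ T) htT (A := A) (J := I ∩ T)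
    (hIT Finset.inter_subset_left Finset.inter_subset_right) (by omega) L.card
    fun K hK b hb s => ?_
  have hKT : ∀ j ∈ K, j ∈ T := fun j hj => (Finset.mem_inter.1 (hK hj)).2
  have hdLK : Disjoint L K := Finset.disjoint_left.2 fun j hj hj' => hJT j (hL hj) (hKT j hj')
  have e1 : ξ (L ∪ K) = ξ K := hξc _ _ fun j hj => by
    simpa using fun h => absurd hj (hJT j (hL h))
  have e2 : η (L ∪ K) = η L := hηc _ _ fun j hj => by
    simpa using fun h => absurd (hKT j h) hj
  have := hsep (L ∪ K) (Finset.union_subset (hL.trans hJI) (hK.trans Finset.inter_subset_left)) b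
    (by rwa [Finset.card_union_of_disjoint hdLK, ← add_assoc]) s' (by rwa [e2]) s
  rwa [if_neg hBs', e1] at this

end
/-! ### Circuits -/

lemma csignPhase_eq {Q : Type} (S : Finset Q) (s : Q → Fin 2) :
    csignPhase S s = 1 - 2 * (if AllOnes S s then 1 else 0) := by
  unfold csignPhase
  split_ifs with h
  · rw [Finset.prod_eq_one fun j hj => by rw [h j hj]; rfl]; norm_num
  · obtain ⟨j, hj, hs⟩ : ∃ j ∈ S, s j ≠ 1 := by simpa [AllOnes] using h
    rw [Finset.prod_eq_zero hj (by
      have := Fin.val_ne_iff.2 hs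
      simp only [Fin.val_one] at this
      omega)]
    norm_num

section
variable {Q : Type} [DecidableEq Q] [Fintype Q]

lemma sum_prod_apply (F : Q → Fin 2 → ℂ) :
    ∑ r : Q → Fin 2, ∏ j, F j (r j) = ∏ j, ∑ a, F j a := by
  rw [Finset.prod_univ_sum, Fintype.piFinset_univ]

lemma singleQubitOp_mulVec_prodVec (U : Q → Matrix.unitaryGroup (Fin 2) ℂ)
    (p : Q → Fin 2 → ℂ) :
    singleQubitOp U *ᵥ prodVec p Finset.univ = prodVec (fun j => (U j).1 *ᵥ p j) Finset.univ := by
  funext s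
  simp only [Matrix.mulVec, dotProduct, singleQubitOp, Matrix.of_apply, prodVec,
    ← Finset.prod_mul_distrib]
  exact sum_prod_apply fun j a => (U j).1 (s j) a * p j a

lemma singleQubitOp_mulVec_singleQubitOp_mulVec (U V : Q → Matrix.unitaryGroup (Fin 2) ℂ)
    (ψ : Vec Q) :
    singleQubitOp U *ᵥ (singleQubitOp V *ᵥ ψ) = singleQubitOp (U * V) *ᵥ ψ := by
  rw [Matrix.mulVec_mulVec]
  congr 1
  ext s r
  simp only [Matrix.mul_apply, singleQubitOp, Matrix.of_apply, ← Finset.prod_mul_distrib]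
  rw [sum_prod_apply fun j a => (U j).1 (s j) a * (V j).1 a (r j)]
  rfl

lemma ket_eq_prodVec (z : Q → Fin 2) :
    ket z = prodVec (fun j a => if a = z j then 1 else 0) Finset.univ := by
  funext s
  simp only [ket, prodVec, Finset.prod_boole, Pi.single_apply, funext_iff, Finset.mem_univ,
    forall_true_left]

lemma singleQubitOp_mulVec_ket (U : Q → Matrix.unitaryGroup (Fin 2) ℂ) (z : Q → Fin 2) :
    singleQubitOp U *ᵥ ket z = prodVec (fun j a => (U j).1 a (z j)) Finset.univ := by
  rw [ket_eq_prodVec, singleQubitOp_mulVec_prodVec]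
  congr 1
  funext j a
  simp [Matrix.mulVec, dotProduct]

/-- The gates of a layer, together with the singletons of the qubits that no gate touches: a
partition of the qubits (up to a gate on the empty set). -/
def CSignLayer.blocks (L : CSignLayer Q) : Finset (Finset Q) :=
  L.gates ∪ (Finset.univ.filter fun j => ∀ S ∈ L.gates, j ∉ S).image singleton

/-- The weight that distinguishes the gates of a layer from the other blocks. -/
def CSignLayer.weight (L : CSignLayer Q) (T : Finset Q) : ℂ := if T ∈ L.gates then 1 else 0

lemma CSignLayer.blocks_pairwiseDisjoint (L : CSignLayer Q) :
    (L.blocks : Set (Finset Q)).PairwiseDisjoint id := by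
  intro S hS T hT hST
  simp only [blocks, Finset.coe_union, Finset.coe_image, Set.mem_union, Finset.mem_coe,
    Set.mem_image, Finset.mem_filter, Finset.mem_univ, true_and] at hS hT
  rcases hS with hS | ⟨j, hj, rfl⟩ <;> rcases hT with hT | ⟨k, hk, rfl⟩
  · exact L.disjoint hS hT hST
  · simpa [Function.onFun] using hk S hS
  · simpa [Function.onFun] using hj T hT
  · simpa [Function.onFun] using hST

lemma CSignLayer.exists_mem_blocks (L : CSignLayer Q) (j : Q) : ∃ T ∈ L.blocks, j ∈ T := by
  by_cases h : ∃ S ∈ L.gates, j ∈ S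
  · obtain ⟨S, hS, hj⟩ := h
    exact ⟨S, Finset.mem_union_left _ hS, hj⟩
  · push Not at h
    exact ⟨{j}, Finset.mem_union_right _ (Finset.mem_image_of_mem _ (by simpa using h)), by simp⟩

lemma CSignLayer.op_mulVec_apply (L : CSignLayer Q) (ψ : Vec Q) (s : Q → Fin 2) :
    (L.op *ᵥ ψ) s =
      (∏ T ∈ L.blocks, (1 - 2 * L.weight T * (if AllOnes T s then 1 else 0))) * ψ s := by
  rw [CSignLayer.op, Matrix.mulVec_diagonal]
  congr 1
  have hsub : L.gates ⊆ L.blocks := Finset.subset_union_left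
  rw [← Finset.prod_subset hsub fun T _ hT => by simp [weight, hT]]
  exact Finset.prod_congr rfl fun S hS => by rw [csignPhase_eq]; simp [weight, hS]

/-- Single-qubit operations after C-SIGN gates on disjoint sets, applied to a product state. Here
`F j` is the product of a row of the operation on the qubit `j` and of the state of that qubit. -/
lemma sum_prod_gates_mul_prod (w : Finset Q → ℂ) (𝒯 : Finset (Finset Q))
    (hd : (𝒯 : Set (Finset Q)).PairwiseDisjoint id) (F : Q → Fin 2 → ℂ) :
    ∑ r : Q → Fin 2, (∏ T ∈ 𝒯, (1 - 2 * w T * (if AllOnes T r then 1 else 0))) *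
        ∏ j, F j (r j) =
      (∏ T ∈ 𝒯, (∏ j ∈ T, ∑ a, F j a - 2 * w T * ∏ j ∈ T, F j 1)) *
        ∏ j with ∀ T ∈ 𝒯, j ∉ T, ∑ a, F j a := by
  induction 𝒯 using Finset.induction_on generalizing F with
  | empty => simpa using sum_prod_apply F
  | insert T 𝒯 hT ih =>
    have hd' : (𝒯 : Set (Finset Q)).PairwiseDisjoint id := hd.subset (by simp)
    have hdT : ∀ S ∈ 𝒯, Disjoint T S := fun S hS =>
      hd (by simp) (by simp [hS]) fun h => hT (h ▸ hS)
    set G : Q → Fin 2 → ℂ := fun j a => if j ∈ T then (if a = 1 then F j a else 0) else F j a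
      with hG
    have hGT : ∀ j ∈ T, ∑ a, G j a = F j 1 := fun j hj => by simp [hG, hj]
    have hGn : ∀ j ∉ T, G j = F j := fun j hj => by simp [hG, hj]
    have hind : ∀ r : Q → Fin 2,
        (if AllOnes T r then (1 : ℂ) else 0) * ∏ j, F j (r j) = ∏ j, G j (r j) := by
      intro r
      split_ifs with h
      · rw [one_mul]
        refine Finset.prod_congr rfl fun j _ => ?_
        by_cases hj : j ∈ T <;> simp [hG, hj, h j]
      · obtain ⟨j, hj, hr⟩ : ∃ j ∈ T, r j ≠ 1 := by simpa [AllOnes] using h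
        rw [zero_mul, Finset.prod_eq_zero (Finset.mem_univ j)]
        simp [hG, hj, hr]
    have hsplit : ∀ H : Q → ℂ, ∏ j with ∀ S ∈ 𝒯, j ∉ S, H j =
        (∏ j ∈ T, H j) * ∏ j with ∀ S ∈ insert T 𝒯, j ∉ S, H j := by
      intro H
      have hsub : T ⊆ Finset.univ.filter fun j => ∀ S ∈ 𝒯, j ∉ S := fun j hj => by
        simpa using fun S hS => Finset.disjoint_left.1 (hdT S hS) hj
      rw [← Finset.prod_sdiff hsub, mul_comm]
      congr 2
      ext j
      simp [and_comm]
    have hG1 : ∏ S ∈ 𝒯, (∏ j ∈ S, ∑ a, G j a - 2 * w S * ∏ j ∈ S, G j 1) =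
        ∏ S ∈ 𝒯, (∏ j ∈ S, ∑ a, F j a - 2 * w S * ∏ j ∈ S, F j 1) :=
      Finset.prod_congr rfl fun S hS => by
        have hn : ∀ j ∈ S, j ∉ T := fun j hj => Finset.disjoint_right.1 (hdT S hS) hj
        have h1 : ∏ j ∈ S, ∑ a, G j a = ∏ j ∈ S, ∑ a, F j a :=
          Finset.prod_congr rfl fun j hj => by rw [hGn j (hn j hj)]
        have h2 : ∏ j ∈ S, G j 1 = ∏ j ∈ S, F j 1 :=
          Finset.prod_congr rfl fun j hj => by rw [hGn j (hn j hj)]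
        rw [h1, h2]
    have hG2 : ∏ j with ∀ S ∈ insert T 𝒯, j ∉ S, ∑ a, G j a =
        ∏ j with ∀ S ∈ insert T 𝒯, j ∉ S, ∑ a, F j a :=
      Finset.prod_congr rfl fun j hj => by
        rw [hGn j ((Finset.mem_filter.1 hj).2 T (Finset.mem_insert_self _ _))]
    have hexp : ∀ r : Q → Fin 2,
        (∏ S ∈ insert T 𝒯, (1 - 2 * w S * (if AllOnes S r then 1 else 0))) * ∏ j, F j (r j) =
          (∏ S ∈ 𝒯, (1 - 2 * w S * (if AllOnes S r then 1 else 0))) * ∏ j, F j (r j) -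
            2 * w T * ((∏ S ∈ 𝒯, (1 - 2 * w S * (if AllOnes S r then 1 else 0))) *
              ∏ j, G j (r j)) := by
      intro r
      rw [Finset.prod_insert hT, ← hind]
      ring
    rw [Finset.sum_congr rfl fun r _ => hexp r, Finset.sum_sub_distrib, ← Finset.mul_sum,
      ih hd' F, ih hd' G, hsplit, hsplit, hG1, hG2, Finset.prod_insert hT,
      Finset.prod_congr (s₁ := T) (g := fun j => F j 1) rfl hGT]
    ring

/-- The state after the first layer and the following single-qubit gates is a product over the
blocks of the layer. -/
lemma singleQubitOp_mulVec_layer_mulVec_ket (U V : Q → Matrix.unitaryGroup (Fin 2) ℂ)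
    (L : CSignLayer Q) (K : Finset Q) :
    singleQubitOp V *ᵥ (L.op *ᵥ (singleQubitOp U *ᵥ ket (bits K))) =
      blocksVec (fun j => (V j * U j).1) (fun j a => (V j).1 a 1)
        (fun T K => 2 * L.weight T * ∏ j ∈ T, (U j).1 1 (bits K j)) L.blocks K := by
  funext s
  rw [singleQubitOp_mulVec_ket]
  have h := sum_prod_gates_mul_prod L.weight L.blocks L.blocks_pairwiseDisjoint
    (fun j a => (V j).1 (s j) a * (U j).1 a (bits K j))
  rw [Finset.filter_false_of_mem, Finset.prod_empty, mul_one] at h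
  · simp only [Matrix.mulVec, dotProduct, singleQubitOp, Matrix.of_apply] at h ⊢
    refine Eq.trans (Finset.sum_congr rfl fun r _ => ?_)
      (h.trans (Finset.prod_congr rfl fun T _ => ?_))
    · have := L.op_mulVec_apply (prodVec (fun j a => (U j).1 a (bits K j)) Finset.univ) r
      simp only [Matrix.mulVec, dotProduct] at this
      rw [this, Finset.prod_mul_distrib]
      simp only [prodVec]
      ring
    · simp only [blockVec, colVec, prodVec, Finset.prod_mul_distrib]
      congr 1
      ring
  · intro j _ hj
    obtain ⟨T, hT, hjT⟩ := L.exists_mem_blocks j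
    exact hj T hT hjT

/-- If the amplitudes with value `b` of the target `t` vanish after the last single-qubit gates,
then they vanish after the gate on `t` alone. -/
lemma sum_update_eq_zero (U : Q → Matrix.unitaryGroup (Fin 2) ℂ) (ψ : Vec Q) (t : Q) (b : Fin 2)
    (h : ∀ s, s t = b → (singleQubitOp U *ᵥ ψ) s = 0) (s : Q → Fin 2) :
    ∑ a, (U t).1 b a * ψ (Function.update s t a) = 0 := by
  set V : Q → Matrix.unitaryGroup (Fin 2) ℂ := fun j => if j = t then 1 else (U j)⁻¹ with hV
  set φ := singleQubitOp U *ᵥ ψ with hφ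
  have h1 : (singleQubitOp V *ᵥ φ) (Function.update s t b) = 0 := by
    refine Finset.sum_eq_zero fun r _ => ?_
    by_cases hr : r t = b
    · rw [h r hr, mul_zero]
    · have h0 : singleQubitOp V (Function.update s t b) r = 0 :=
        Finset.prod_eq_zero (Finset.mem_univ t) ?_
      · exact (congrArg (· * φ r) h0).trans (zero_mul _)
      simp [hV, Ne.symm hr]
  rw [hφ, singleQubitOp_mulVec_singleQubitOp_mulVec] at h1
  have hVU : ∀ j, (V * U) j = if j = t then U t else 1 := fun j => by
    by_cases hj : j = t
    · subst hj; simp [hV]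
    · simp [hV, hj]
  rw [← h1]
  symm
  rw [Matrix.mulVec, dotProduct]
  rw [← Finset.sum_subset (Finset.subset_univ
    (Finset.univ.image fun a : Fin 2 => Function.update s t a)), Finset.sum_image]
  · refine Finset.sum_congr rfl fun a _ => ?_
    congr 1
    rw [singleQubitOp, Matrix.of_apply, ← Finset.mul_prod_erase _ _ (Finset.mem_univ t),
      Finset.prod_eq_one, mul_one]
    · simp [hVU]
    · intro j hj
      have hjt := Finset.ne_of_mem_erase hj
      simp [hVU, hjt]
  · intro a _ a' _ haa
    simpa using congrFun haa t
  · intro r _ hr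
    have : ∃ j, j ≠ t ∧ s j ≠ r j := by
      by_contra! hcon
      refine hr (Finset.mem_image.2 ⟨r t, Finset.mem_univ _, funext fun j => ?_⟩)
      by_cases hj : j = t
      · subst hj; simp
      · simp [hj, hcon j hj]
    obtain ⟨j, hjt, hj⟩ := this
    rw [singleQubitOp, Matrix.of_apply, Finset.prod_eq_zero (Finset.mem_univ j), zero_mul]
    simp [hVU, hjt, hj]

/-- Gates of a layer that do not touch the target can be removed: they are diagonal, with entries
that are not zero and do not depend on the value of the target. -/
lemma targetAmp_eq_zero_of_layer (L : CSignLayer Q) (u : Matrix (Fin 2) (Fin 2) ℂ) (ψ : Vec Q)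
    {t : Q} {b : Fin 2} {S : Finset Q} (hS : S ∈ L.blocks) (htS : t ∈ S) (s : Q → Fin 2)
    (h : ∑ a, u b a * (L.op *ᵥ ψ) (Function.update s t a) = 0) :
    targetAmp u (S.erase t) (L.weight S) t ψ b s = 0 := by
  have hd : ∀ T ∈ L.blocks.erase S, t ∉ T := fun T hT => Finset.disjoint_left.1
    (L.blocks_pairwiseDisjoint hS (Finset.mem_of_mem_erase hT)
      (Finset.ne_of_mem_erase hT).symm) htS
  have hones : ∀ a : Fin 2, AllOnes S (Function.update s t a) ↔ a = 1 ∧ AllOnes (S.erase t) s := by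
    intro a
    constructor
    · refine fun hS1 => ⟨by simpa using hS1 t htS, fun j hj => ?_⟩
      simpa [Finset.ne_of_mem_erase hj] using hS1 j (Finset.mem_of_mem_erase hj)
    · rintro ⟨ha, hs⟩ j hj
      by_cases hjt : j = t
      · subst hjt; simpa using ha
      · simpa [hjt] using hs j (Finset.mem_erase.2 ⟨hjt, hj⟩)
  set c : ℂ := ∏ T ∈ L.blocks.erase S, (1 - 2 * L.weight T * (if AllOnes T s then 1 else 0))
    with hc
  have hc0 : c ≠ 0 := Finset.prod_ne_zero_iff.2 fun T _ => by
    unfold CSignLayer.weight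
    split_ifs <;> norm_num
  have hL : ∀ a, (L.op *ᵥ ψ) (Function.update s t a) =
      c * ((if a = 1 ∧ AllOnes (S.erase t) s then 1 - 2 * L.weight S else 1) *
        ψ (Function.update s t a)) := by
    intro a
    rw [L.op_mulVec_apply, ← Finset.mul_prod_erase _ _ hS,
      Finset.prod_congr (s₁ := L.blocks.erase S)
        (g := fun T => 1 - 2 * L.weight T * (if AllOnes T s then 1 else 0)) rfl fun T hT => ?_]
    · simp only [hones, ← hc]
      split_ifs <;> ring
    · have : AllOnes T (Function.update s t a) ↔ AllOnes T s := allOnes_congr fun j hj => by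
        rw [Function.update_of_ne fun h : j = t => hd T hT (h ▸ hj)]
      simp only [this]
  simp only [hL] at h
  refine (mul_eq_zero.1 (?_ : c * _ = 0)).resolve_left hc0
  rw [← h, targetAmp, Finset.mul_sum]
  exact Finset.sum_congr rfl fun a _ => by ring

/-- A depth-2 circuit does not compute the parity of four bits: the value of the qubit `t` at the
end is not determined, for all the sets `K` of ones among at least four qubits, by the parity of
`K`. -/
lemma Circuit.not_forall_amplitude_eq_zero (C : Circuit Q 2) {I : Finset Q} {t : Q} (htI : t ∉ I)
    (hI : 4 ≤ I.card) (hne : ∀ K ⊆ I, C.op *ᵥ ket (bits K) ≠ 0)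
    (h : ∀ K ⊆ I, ∀ s, Odd ((s t : ℕ) + K.card) → (C.op *ᵥ ket (bits K)) s = 0) : False := by
  rcases C with _ | ⟨C, L₂, U₂⟩
  rcases C with _ | ⟨C, L₁, U₁⟩
  rcases C with ⟨U₀⟩
  obtain ⟨S, hS, htS⟩ := L₂.exists_mem_blocks t
  have hop : ∀ K, ((Circuit.base U₀).step L₁ U₁ |>.step L₂ U₂).op *ᵥ ket (bits K) =
      singleQubitOp U₂ *ᵥ (L₂.op *ᵥ blocksVec (fun j => (U₁ j * U₀ j).1) (fun j a => (U₁ j).1 a 1)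
        (fun T K => 2 * L₁.weight T * ∏ j ∈ T, (U₀ j).1 1 (bits K j)) L₁.blocks K) := by
    intro K
    rw [← singleQubitOp_mulVec_layer_mulVec_ket]
    simp only [Circuit.op, Matrix.mulVec_mulVec, Matrix.mul_assoc]
  refine not_targetAmp_blocksVec_eq_zero L₁.blocks_pairwiseDisjoint L₁.exists_mem_blocks
    (fun j => U₁ j * U₀ j) (U₂ t) (fun j a => (U₁ j).1 a 1)
    (fun T K => 2 * L₁.weight T * ∏ j ∈ T, (U₀ j).1 1 (bits K j)) ?_ (S := S)
    (lam := L₂.weight S) ?_ htI hI ?_ ?_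
  · intro T K K' hK
    exact congrArg _ (Finset.prod_congr rfl fun j hj => by simp only [bits, hK j hj])
  · unfold CSignLayer.weight
    split_ifs <;> simp
  · intro K hK
    by_contra! h0
    apply hne K hK
    rw [hop, funext h0]
    exact (congrArg _ (Matrix.mulVec_zero _)).trans (Matrix.mulVec_zero _)
  · intro K hK b hb s
    refine targetAmp_eq_zero_of_layer L₂ _ _ hS htS s (sum_update_eq_zero U₂ _ t b ?_ s)
    intro r hr
    rw [← hop]
    exact h K hK r (by rwa [hr])

end
/-! ### Circuits that compute the parity -/

section

lemma tensor_ket_ket {A B : Type} [Fintype A] [DecidableEq A] [Fintype B] [DecidableEq B]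
    (a : A → Fin 2) (b : B → Fin 2) : tensor (ket a) (ket b) = ket (Sum.elim a b) := by
  funext s
  have : s = Sum.elim a b ↔ (fun i => s (Sum.inl i)) = a ∧ (fun i => s (Sum.inr i)) = b := by
    constructor
    · rintro rfl; exact ⟨rfl, rfl⟩
    · rintro ⟨rfl, rfl⟩; exact (Sum.elim_comp_inl_inr s).symm
  simp only [tensor, ket, Pi.single_apply, this, ite_and, mul_ite, mul_one, mul_zero]
  split_ifs <;> rfl

lemma isState_ket {Q : Type} [Fintype Q] [DecidableEq Q] (z : Q → Fin 2) : IsState (ket z) := by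
  rw [IsState, Finset.sum_eq_single z]
  · simp [ket]
  · intro s _ hs
    simp [ket, hs]
  · simp

lemma Circuit.not_computes_parity {n m : ℕ} (hn : 3 < n) (C : Circuit (Register n m) 2) :
    ¬ C.Computes (parity n) := by
  intro hC
  let e : Fin n ↪ Register n m := ⟨fun i => Sum.inr (Sum.inl i), fun i j h => by simpa using h⟩
  have hfin : ∀ K ⊆ Finset.univ.map e, ∃ (b : Fin 2) (φ : Vec (Fin n ⊕ Fin m)), IsState φ ∧
      (b : ℕ) = K.card % 2 ∧ C.op *ᵥ ket (bits K) = tensor (ket fun _ : Unit => b) φ := by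
    intro K hK
    obtain ⟨φ, hφ, h⟩ := hC fun i => bits K (e i)
    refine ⟨_, φ, hφ, ?_, (congrArg (C.op *ᵥ ·) ?_).trans h⟩
    · have hsum : ∑ i, (bits K (e i) : ℕ) = K.card := by
        have h1 : ∀ j, (bits K j : ℕ) = if j ∈ K then 1 else 0 := fun j => by
          unfold bits; split_ifs <;> rfl
        rw [← Finset.sum_map Finset.univ e (fun j => (bits K j : ℕ))]
        simp only [h1]
        rw [Finset.sum_ite_mem, Finset.inter_eq_right.2 hK]
        simp
      simp [parity, hsum]
    · rw [tensor_ket_ket, tensor_ket_ket]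
      congr 2
      funext j
      rcases j with _ | i | i
      · exact if_neg fun h => by simpa [e] using hK h
      · rfl
      · refine if_neg fun h => ?_
        obtain ⟨i', -, h'⟩ := Finset.mem_map.1 (hK h)
        exact absurd (Sum.inr_injective h') Sum.inl_ne_inr
  refine C.not_forall_amplitude_eq_zero (I := Finset.univ.map e) (t := Sum.inl ())
    (by simp [e]) (by simpa using Nat.succ_le_of_lt hn) ?_ ?_
  · intro K hK h0
    obtain ⟨b, φ, hφ, -, h⟩ := hfin K hK
    rw [h0] at h
    have hz : ∀ s, φ s = 0 := fun s => by
      have := congrFun h (Sum.elim (fun _ => b) s)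
      simpa [tensor, ket] using this.symm
    simp [IsState, hz] at hφ
  · intro K hK s hodd
    obtain ⟨b, φ, -, hb, h⟩ := hfin K hK
    rw [h, tensor, ket, Pi.single_eq_of_ne, zero_mul]
    intro hs
    have hsb : s (Sum.inl ()) = b := congrFun hs ()
    rw [hsb, hb, Nat.odd_iff] at hodd
    omega

end

/-! ### Three bits -/

section

/-- The Hadamard matrix, whose entries are `(-1) ^ (a * b) / √2`. -/
noncomputable def hadamardMatrix : Matrix (Fin 2) (Fin 2) ℂ :=
  Matrix.of fun a b => ((√2 : ℝ) : ℂ)⁻¹ * (-1) ^ ((a : ℕ) * b)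

lemma hadamardMatrix_mul_self : hadamardMatrix * hadamardMatrix = 1 := by
  have h : ((√2 : ℝ) : ℂ)⁻¹ * ((√2 : ℝ) : ℂ)⁻¹ = 1 / 2 := by
    rw [← mul_inv, ← Complex.ofReal_mul, Real.mul_self_sqrt (by norm_num)]
    norm_num
  ext a b
  fin_cases a <;> fin_cases b <;> (simp [Matrix.mul_apply, hadamardMatrix, h]; try norm_num)

lemma star_hadamardMatrix : star hadamardMatrix = hadamardMatrix := by
  ext a b
  simp [hadamardMatrix, Matrix.star_apply, mul_comm (a : ℕ)]

/-- The Hadamard gate. -/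
noncomputable def hadamard : Matrix.unitaryGroup (Fin 2) ℂ :=
  ⟨hadamardMatrix, Matrix.mem_unitaryGroup_iff.2 (by
    rw [star_hadamardMatrix, hadamardMatrix_mul_self])⟩

/-- The state `|b⟩` of one qubit. -/
def basisVec (b : Fin 2) : Fin 2 → ℂ := fun a => if a = b then 1 else 0

/-- The state `H|b⟩` of one qubit. -/
noncomputable def hadVec (b : Fin 2) : Fin 2 → ℂ := fun a => hadamardMatrix a b

lemma hadamard_mulVec_basisVec (b : Fin 2) : hadamard.1 *ᵥ basisVec b = hadVec b := by
  funext a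
  simp [basisVec, hadVec, hadamard, Matrix.mulVec, dotProduct]

lemma hadamard_mulVec_hadVec (b : Fin 2) : hadamard.1 *ᵥ hadVec b = basisVec b := by
  rw [← hadamard_mulVec_basisVec, Matrix.mulVec_mulVec]
  simp only [hadamard, hadamardMatrix_mul_self, Matrix.one_mulVec]

/-- Between Hadamard gates on its target, a C-SIGN gate on two qubits is a controlled negation. -/
lemma sign_mul_hadVec_mul_basisVec (a b c d : Fin 2) :
    (-1) ^ ((a : ℕ) * b) * (hadVec c a * basisVec d b) = hadVec (c + d) a * basisVec d b := by
  have h2 : (1 + 1 : Fin 2) = 0 := rfl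
  fin_cases a <;> fin_cases b <;> fin_cases c <;> fin_cases d <;>
    simp [hadVec, basisVec, hadamardMatrix, h2]

/-- A family indexed by the four qubits: the target and the three inputs. -/
def reg {α : Type} (a b c d : α) : Register 3 0 → α :=
  Sum.elim (fun _ => a) (Sum.elim ![b, c, d] Fin.elim0)

lemma prodVec_reg (a b c d : Fin 2 → ℂ) (s : Register 3 0 → Fin 2) :
    prodVec (reg a b c d) Finset.univ s = a (s (Sum.inl ())) * (b (s (Sum.inr (Sum.inl 0))) *
      c (s (Sum.inr (Sum.inl 1))) * d (s (Sum.inr (Sum.inl 2)))) := by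
  simp [prodVec, reg, Fin.prod_univ_three]

lemma singleQubitOp_mulVec_reg (A B C D : Matrix.unitaryGroup (Fin 2) ℂ) (a b c d : Fin 2 → ℂ) :
    singleQubitOp (reg A B C D) *ᵥ prodVec (reg a b c d) Finset.univ =
      prodVec (reg (A.1 *ᵥ a) (B.1 *ᵥ b) (C.1 *ᵥ c) (D.1 *ᵥ d)) Finset.univ := by
  rw [singleQubitOp_mulVec_prodVec]
  congr 1
  funext j
  rcases j with _ | i | i
  · rfl
  · fin_cases i <;> rfl
  · exact i.elim0

/-- The gates of the first layer of a circuit for three bits: the first input is added to the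
target and the third input to the second. -/
def firstLayer : CSignLayer (Register 3 0) where
  gates := {{Sum.inl (), Sum.inr (Sum.inl 0)}, {Sum.inr (Sum.inl 1), Sum.inr (Sum.inl 2)}}
  disjoint := by
    rw [Finset.coe_pair, Set.pairwiseDisjoint_insert]
    simp [Finset.disjoint_left]

/-- The gate of the second layer of a circuit for three bits: the sum of the second and the third
input is added to the target. -/
def secondLayer : CSignLayer (Register 3 0) where
  gates := {{Sum.inl (), Sum.inr (Sum.inl 1)}}
  disjoint := by simp

lemma firstLayer_op_mulVec (a b c d : Fin 2) :
    firstLayer.op *ᵥ prodVec (reg (hadVec a) (basisVec b) (hadVec c) (basisVec d)) Finset.univ =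
      prodVec (reg (hadVec (a + b)) (basisVec b) (hadVec (c + d)) (basisVec d)) Finset.univ := by
  funext s
  rw [CSignLayer.op, Matrix.mulVec_diagonal, firstLayer, Finset.prod_pair (by decide)]
  simp only [csignPhase]
  rw [Finset.prod_pair (by decide), Finset.prod_pair (by decide), prodVec_reg, prodVec_reg]
  have h1 := sign_mul_hadVec_mul_basisVec (s (Sum.inl ())) (s (Sum.inr (Sum.inl 0))) a b
  have h2 := sign_mul_hadVec_mul_basisVec (s (Sum.inr (Sum.inl 1))) (s (Sum.inr (Sum.inl 2))) c d
  linear_combination (hadVec (c + d) (s (Sum.inr (Sum.inl 1))) *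
    basisVec d (s (Sum.inr (Sum.inl 2)))) * h1 + (-1) ^ ((s (Sum.inl ()) : ℕ) *
      s (Sum.inr (Sum.inl 0))) * (hadVec a (s (Sum.inl ())) *
        basisVec b (s (Sum.inr (Sum.inl 0)))) * h2

lemma secondLayer_op_mulVec (a b c d : Fin 2) :
    secondLayer.op *ᵥ
        prodVec (reg (hadVec a) (basisVec b) (basisVec c) (basisVec d)) Finset.univ =
      prodVec (reg (hadVec (a + c)) (basisVec b) (basisVec c) (basisVec d)) Finset.univ := by
  funext s
  rw [CSignLayer.op, Matrix.mulVec_diagonal, secondLayer, Finset.prod_singleton, csignPhase,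
    Finset.prod_pair (by decide), prodVec_reg, prodVec_reg]
  have h1 := sign_mul_hadVec_mul_basisVec (s (Sum.inl ())) (s (Sum.inr (Sum.inl 1))) a c
  linear_combination basisVec b (s (Sum.inr (Sum.inl 0))) *
    basisVec d (s (Sum.inr (Sum.inl 2))) * h1

lemma ket_reg (a b c d : Fin 2) :
    ket (reg a b c d) =
      prodVec (reg (basisVec a) (basisVec b) (basisVec c) (basisVec d)) Finset.univ := by
  rw [ket_eq_prodVec]
  congr 1
  funext j k
  rcases j with _ | i | i
  · rfl
  · fin_cases i <;> rfl
  · exact i.elim0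

lemma exists_computes_parity_three : ∃ C : Circuit (Register 3 0) 2, C.Computes (parity 3) := by
  refine ⟨((Circuit.base (reg hadamard 1 hadamard 1)).step firstLayer (reg 1 1 hadamard 1)).step
    secondLayer (reg hadamard 1 1 1), fun x => ?_⟩
  refine ⟨ket (Sum.elim ![x 0, x 1 + x 2, x 2] Fin.elim0), isState_ket _, ?_⟩
  have hin : tensor (ket fun _ : Unit => 0) (tensor (ket x) (ket fun _ : Fin 0 => 0)) =
      ket (reg 0 (x 0) (x 1) (x 2)) := by
    rw [tensor_ket_ket, tensor_ket_ket]
    congr 1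
    funext j
    rcases j with _ | i | i
    · rfl
    · fin_cases i <;> rfl
    · exact i.elim0
  have hpar : parity 3 x = 0 + x 0 + (x 1 + x 2) := by
    simp only [parity, Fin.sum_univ_three]
    generalize x 0 = a, x 1 = b, x 2 = c
    revert a b c
    decide
  have hout : tensor (ket fun _ : Unit => parity 3 x)
      (ket (Sum.elim ![x 0, x 1 + x 2, x 2] Fin.elim0)) =
        ket (reg (0 + x 0 + (x 1 + x 2)) (x 0) (x 1 + x 2) (x 2)) := by
    rw [tensor_ket_ket, hpar]; rfl
  rw [hin, hout, ket_reg, ket_reg]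
  simp only [Circuit.op, ← Matrix.mulVec_mulVec, singleQubitOp_mulVec_reg,
    hadamard_mulVec_basisVec, OneMemClass.coe_one, Matrix.one_mulVec, firstLayer_op_mulVec,
    hadamard_mulVec_hadVec, secondLayer_op_mulVec]

end

end QAC

theorem mainTheorem1 :
    (∀ n : ℕ, 3 < n → ∀ (m : ℕ) (C : QAC.Circuit (QAC.Register n m) 2),
      ¬ C.Computes (QAC.parity n)) ∧
    ∃ C : QAC.Circuit (QAC.Register 3 0) 2, C.Computes (QAC.parity 3) :=
  ⟨fun _ hn _ C => C.not_computes_parity hn, QAC.exists_computes_parity_three⟩
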